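/- Let $\mathcal C$ be an abelian category which admits small colimits and in which small filtered colimits are exact, and let $\Lambda$ be a small filtrant (nonempty, directed) preordered set, regarded as a category. Let $\mathrm{Fct}(\Lambda,\mathcal C)$ be the abelian category of functors $\Lambda\to\mathcal C$, let $\mathrm F_\Lambda\mathcal C$ be its full subcategory of $\Lambda$-filtered objects, i.e. of the functors sending every morphism of $\Lambda$ to a monomorphism, and let $\iota\colon \mathrm F_\Lambda\mathcal C\hookrightarrow \mathrm{Fct}(\Lambda,\mathcal C)$ be the inclusion. Let $\kappa\colon \mathrm{Fct}(\Lambda,\mathcal C)\to \mathrm F_\Lambda\mathcal C$ be the left adjoint of $\iota$ given by $\kappa(M)(\lambda)=\mathrm{im}\big(M(\lambda)\to\varinjlim M\big)$. In an additive category with kernels and cokernels, a morphism $f$ is called strict if the canonical morphism $\mathrm{coim} f\to\mathrm{im} f$ is an isomorphism; a sequence $X'\xrightarrow{f}X\xrightarrow{g}X''$ with $gf=0$ is strictly exact if $f$ is strict and $\mathrm{im} f\to\ker g$ is an isomorphism; an additive functor is strictly exact if it sends strictly exact sequences $X'\to X\to X''$ to strictly exact sequences. A complex $X$ is strictly exact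 in degree $n$ if $X^{n-1}\to X^n\to X^{n+1}$ is strictly exact, and strictly exact if this holds for all $n$. For $*=\mathrm{ub},\mathrm b,+,-$, $\mathrm K^*$ is the homotopy category of complexes with no boundedness condition, resp. with $X^n=0$ for $|n|\gg0$, $n\ll0$, $n\gg0$; $\mathrm D^*$ is the localization of $\mathrm K^*$ at the morphisms whose mapping cone is strictly exact, and $\mathrm D=\mathrm D^{\mathrm{ub}}$. (For an abelian category this is the usual derived category.) The left heart $\mathrm{LH}$ is the full subcategory $\mathrm D^{\le0}\cap\mathrm D^{\ge0}$ of $\mathrm D$, where $\mathrm D^{\le 0}$ (resp. $\mathrm D^{\ge0}$) consists of the objects represented by complexes that are strictly exact in all degrees $k>0$ (resp. $k<0$). Then: (i) the functor $\iota$ is strictly exact; (ii) for each $*=\mathrm{ub},\mathrm b,+,-$, the functor $\kappa$ has a left derived functor $L\kappa\colon\mathrm D^*(\mathrm{Fct}(\Lambda,\mathcal C))\to\mathrm D^*(\mathrm F_\Lambda\mathcal C)$, and the functor $\iota\colon\mathrm D^*(\mathrm F_\Lambda\mathcal C)\to\mathrm D^*(\mathrm{Fct}(\Lambda,\mathcal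 C))$ induced by $\iota$ is an equivalence of categories with quasi-inverse $L\kappa$; (iii) the left heart $\mathrm{LH}(\mathrm F_\Lambda\mathcal C)$ is an abelian category and $\iota$ induces an equivalence of abelian categories $\mathrm{LH}(\mathrm F_\Lambda\mathcal C)\simeq\mathrm{Fct}(\Lambda,\mathcal C)$, that is, an equivalence whose composition with the embedding $\mathrm{Fct}(\Lambda,\mathcal C)\to\mathrm D(\mathrm{Fct}(\Lambda,\mathcal C))$ in degree $0$ is isomorphic to the restriction to $\mathrm{LH}(\mathrm F_\Lambda\mathcal C)$ of the functor $\iota\colon\mathrm D(\mathrm F_\Lambda\mathcal C)\to\mathrm D(\mathrm{Fct}(\Lambda,\mathcal C))$. -/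

import Mathlib

open CategoryTheory CategoryTheory.Limits

universe w v u v' u'

noncomputable section

/-! ## Strict exactness and derived categories of categories with kernels and cokernels -/

namespace StrictExact

section Basic

variable {C : Type u} [Category.{v} C] [Preadditive C] [HasKernels C] [HasCokernels C]

/-- A morphism is strict if the canonical morphism `coim f ⟶ im f` is an isomorphism, where
`im f = ker (Y ⟶ coker f)` and `coim f = coker (ker f ⟶ X)`. -/
def IsStrict {X Y : C} (f : X ⟶ Y) : Prop :=
  IsIso (Abelian.coimageImageComparison f)

lemma image_ι_comp_eq_zero (S : ShortComplex C) : Abelian.image.ι S.f ≫ S.g = 0 := by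
  rw [← cokernel.π_desc S.f S.g S.zero, kernel.condition_assoc, zero_comp]

/-- A sequence `X₁ ⟶ X₂ ⟶ X₃` with zero composition is strictly exact if its first morphism `f`
is strict and the canonical morphism `im f ⟶ ker g` is an isomorphism. -/
def IsStrictlyExact (S : ShortComplex C) : Prop :=
  IsStrict S.f ∧ IsIso (kernel.lift S.g (Abelian.image.ι S.f) (image_ι_comp_eq_zero S))

/-- The complex `K` is strictly exact in degree `n`: the sequence
`K^{n-1} ⟶ K^n ⟶ K^{n+1}` is strictly exact. -/
def IsStrictlyExactAt (K : CochainComplex C ℤ) (n : ℤ) : Prop :=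
  IsStrictlyExact (K.sc' (n - 1) n (n + 1))

/-- The objects of the homotopy category `K(C)` given by strictly exact complexes. -/
def strictlyExactComplexes : ObjectProperty (HomotopyCategory C (ComplexShape.up ℤ)) :=
  fun X => ∀ n : ℤ, IsStrictlyExactAt X.as n

variable {D : Type u'} [Category.{v'} D] [Preadditive D] [HasKernels D] [HasCokernels D]

/-- An additive functor is strictly exact if it sends every strictly exact sequence
`X₁ ⟶ X₂ ⟶ X₃` to a strictly exact sequence. -/
def IsStrictlyExactFunctor (F : C ⥤ D) [F.Additive] : Prop :=
  ∀ S : ShortComplex C, IsStrictlyExact S → IsStrictlyExact (S.map F)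

lemma IsStrictlyExactFunctor.map_isStrictlyExactAt {F : C ⥤ D} [F.Additive]
    (hF : IsStrictlyExactFunctor F) (K : CochainComplex C ℤ) (n : ℤ)
    (hK : IsStrictlyExactAt K n) :
    IsStrictlyExactAt ((F.mapHomologicalComplex (ComplexShape.up ℤ)).obj K) n :=
  hF (K.sc' (n - 1) n (n + 1)) hK

lemma IsStrictlyExactFunctor.map_strictlyExactComplexes {F : C ⥤ D} [F.Additive]
    (hF : IsStrictlyExactFunctor F) (X : HomotopyCategory C (ComplexShape.up ℤ))
    (hX : strictlyExactComplexes X) :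
    strictlyExactComplexes ((F.mapHomotopyCategory (ComplexShape.up ℤ)).obj X) :=
  fun n => hF.map_isStrictlyExactAt X.as n (hX n)

end Basic

/-- The four boundedness conditions: unbounded, bounded, bounded below (`+`),
bounded above (`-`). -/
inductive Bound : Type
  | ub
  | b
  | plus
  | minus

/-- The objects of `K*(C)`, as a condition on the objects of `K(C)`: `X^n = 0` for
`|n| ≫ 0` (`b`), for `n ≪ 0` (`+`), for `n ≫ 0` (`-`), no condition (`ub`). -/
def bounded (C : Type u) [Category.{v} C] [Preadditive C] (s : Bound) :
    ObjectProperty (HomotopyCategory C (ComplexShape.up ℤ)) :=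
  fun X =>
    match s with
    | Bound.ub => True
    | Bound.b => ∃ N : ℤ, ∀ n : ℤ, N < |n| → IsZero (X.as.X n)
    | Bound.plus => ∃ N : ℤ, ∀ n : ℤ, n < N → IsZero (X.as.X n)
    | Bound.minus => ∃ N : ℤ, ∀ n : ℤ, N < n → IsZero (X.as.X n)

/-- The homotopy category `K*(C)`, a full subcategory of `K(C)`. -/
abbrev KStar (C : Type u) [Category.{v} C] [Preadditive C] (s : Bound) :=
  (bounded C s).FullSubcategory

section KStarMap

variable {C : Type u} [Category.{v} C] [Preadditive C]
  {D : Type u'} [Category.{v'} D] [Preadditive D]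

lemma bounded_map (F : C ⥤ D) [F.Additive] (s : Bound)
    (X : HomotopyCategory C (ComplexShape.up ℤ)) (hX : bounded C s X) :
    bounded D s ((F.mapHomotopyCategory (ComplexShape.up ℤ)).obj X) := by
  cases s with
  | ub => trivial
  | b => exact hX.imp fun N hN n hn => F.map_isZero (hN n hn)
  | plus => exact hX.imp fun N hN n hn => F.map_isZero (hN n hn)
  | minus => exact hX.imp fun N hN n hn => F.map_isZero (hN n hn)

/-- The functor `K*(C) ⥤ K*(D)` given by applying an additive functor `F` termwise. -/
def mapKStar (F : C ⥤ D) [F.Additive] (s : Bound) : KStar C s ⥤ KStar D s :=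
  (bounded D s).lift ((bounded C s).ι ⋙ F.mapHomotopyCategory (ComplexShape.up ℤ))
    (fun X => bounded_map F s X.obj X.property)

end KStarMap

section Derived

variable (C : Type u) [Category.{v} C] [Preadditive C] [HasZeroObject C] [HasBinaryBiproducts C]
  [HasKernels C] [HasCokernels C]

/-- The quasi-isomorphisms of `K*(C)`: the morphisms `f` that fit into a distinguished triangle
`X ⟶ Y ⟶ Z ⟶ X[1]` of `K(C)` with first morphism `f` and with `Z` strictly exact. -/
def qis (s : Bound) : MorphismProperty (KStar C s) :=
  (strictlyExactComplexes (C := C)).trW.inverseImage (bounded C s).ι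

/-- The derived category `D*(C)`: the localization of `K*(C)` at the quasi-isomorphisms. -/
abbrev DStar (s : Bound) := (qis C s).Localization

/-- The localization functor `K*(C) ⥤ D*(C)`. -/
abbrev QStar (s : Bound) : KStar C s ⥤ DStar C s := (qis C s).Q

/-- The functor which sends a complex to the corresponding object of `D(C)`. -/
def toD : CochainComplex C ℤ ⥤ DStar C Bound.ub :=
  (bounded C Bound.ub).lift (HomotopyCategory.quotient C (ComplexShape.up ℤ))
    (fun _ => trivial) ⋙ QStar C Bound.ub

/-- The functor which sends an object of `C` to the corresponding complex concentrated in
degree `0`, as an object of `D(C)`. -/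
def singleD : C ⥤ DStar C Bound.ub :=
  HomologicalComplex.single C (ComplexShape.up ℤ) 0 ⋙ toD C

/-- The objects of `D^{≤ n}(C)`: those given by complexes that are strictly exact in all
degrees `k > n`. -/
def dLE (n : ℤ) : ObjectProperty (DStar C Bound.ub) :=
  fun X => ∃ K : CochainComplex C ℤ,
    (∀ k : ℤ, n < k → IsStrictlyExactAt K k) ∧ Nonempty ((toD C).obj K ≅ X)

/-- The objects of `D^{≥ n}(C)`: those given by complexes that are strictly exact in all
degrees `k < n`. -/
def dGE (n : ℤ) : ObjectProperty (DStar C Bound.ub) :=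
  fun X => ∃ K : CochainComplex C ℤ,
    (∀ k : ℤ, k < n → IsStrictlyExactAt K k) ∧ Nonempty ((toD C).obj K ≅ X)

/-- The objects of the left heart, `D^{≤ 0}(C) ∩ D^{≥ 0}(C)`. -/
def leftHeart : ObjectProperty (DStar C Bound.ub) := dLE C 0 ⊓ dGE C 0

/-- The left heart `LH(C)`, a full subcategory of `D(C)`. -/
abbrev LH := (leftHeart C).FullSubcategory

end Derived

section DerivedFunctor

variable {C : Type u} [Category.{v} C] [Preadditive C] [HasZeroObject C] [HasBinaryBiproducts C]
  [HasKernels C] [HasCokernels C]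
  {D : Type u'} [Category.{v'} D] [Preadditive D] [HasZeroObject D] [HasBinaryBiproducts D]
  [HasKernels D] [HasCokernels D]

lemma IsStrictlyExactFunctor.map_qis {F : C ⥤ D} [F.Additive]
    (hF : IsStrictlyExactFunctor F) (s : Bound) :
    qis C s ≤ (qis D s).inverseImage (mapKStar F s) := by
  intro X Y f hf
  obtain ⟨Z, g, h, hT, hZ⟩ := (ObjectProperty.trW_iff _ _).1 hf
  exact (ObjectProperty.trW_iff _ _).2 ⟨_, _, _,
    (F.mapHomotopyCategory (ComplexShape.up ℤ)).map_distinguished _ hT,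
    hF.map_strictlyExactComplexes Z hZ⟩

/-- A strictly exact functor, seen as a functor `K*(C) ⥤ K*(D)` that preserves
quasi-isomorphisms. -/
def IsStrictlyExactFunctor.localizerMorphism {F : C ⥤ D} [F.Additive]
    (hF : IsStrictlyExactFunctor F) (s : Bound) : LocalizerMorphism (qis C s) (qis D s) where
  functor := mapKStar F s
  map := hF.map_qis s

/-- The functor `D*(C) ⥤ D*(D)` induced by a strictly exact functor `F : C ⥤ D`. -/
def IsStrictlyExactFunctor.mapDStar {F : C ⥤ D} [F.Additive]
    (hF : IsStrictlyExactFunctor F) (s : Bound) : DStar C s ⥤ DStar D s :=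
  (hF.localizerMorphism s).localizedFunctor (QStar C s) (QStar D s)

end DerivedFunctor

end StrictExact

/-! ## Filtered objects -/

namespace FilteredObj

section Defs

variable (Λ : Type w) [SmallCategory Λ] (C : Type u) [Category.{v} C]

/-- The functors `Λ ⥤ C` which send every morphism to a monomorphism. -/
def filteredObjects : ObjectProperty (Λ ⥤ C) :=
  fun M => ∀ ⦃i j : Λ⦄ (s : i ⟶ j), Mono (M.map s)

/-- The category `F_Λ C` of `Λ`-filtered objects in `C`. -/
abbrev Filt := (filteredObjects Λ C).FullSubcategory

/-- The inclusion functor `F_Λ C ⥤ Fct(Λ, C)`. -/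
abbrev incl : Filt Λ C ⥤ (Λ ⥤ C) := (filteredObjects Λ C).ι

end Defs

section Kappa

variable {Λ : Type w} [SmallCategory Λ] {C : Type u} [Category.{v} C] [Abelian C]

/-- The morphism between images induced by a commutative square. -/
def imMap {X Y P Q : C} {f : X ⟶ P} {g : Y ⟶ Q} (a : X ⟶ Y) (b : P ⟶ Q)
    (h : a ≫ g = f ≫ b) : image f ⟶ image g :=
  image.map (f := Arrow.mk f) (g := Arrow.mk g) (Arrow.homMk a b h)

lemma imMap_ι {X Y P Q : C} {f : X ⟶ P} {g : Y ⟶ Q} (a : X ⟶ Y) (b : P ⟶ Q)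
    (h : a ≫ g = f ≫ b) : imMap a b h ≫ image.ι g = image.ι f ≫ b :=
  image.map_ι (f := Arrow.mk f) (g := Arrow.mk g) (Arrow.homMk a b h)

lemma factorThruImage_imMap {X Y P Q : C} {f : X ⟶ P} {g : Y ⟶ Q} (a : X ⟶ Y) (b : P ⟶ Q)
    (h : a ≫ g = f ≫ b) :
    factorThruImage f ≫ imMap a b h = a ≫ factorThruImage g := by
  rw [← cancel_mono (image.ι g), Category.assoc, imMap_ι, image.fac_assoc, Category.assoc,
    image.fac, h]

variable [HasColimitsOfShape Λ C]

/-- `κ(M)(i)` is the image of `j_M(i) : M(i) ⟶ M(∞) = colim M`, and the transition morphisms are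
induced by the identity of `M(∞)`. -/
def kappaObj (M : Λ ⥤ C) : Λ ⥤ C where
  obj i := image (colimit.ι M i)
  map s := imMap (M.map s) (𝟙 (colimit M)) (by simp)
  map_id i := by
    rw [← cancel_mono (image.ι (colimit.ι M i)), imMap_ι]
    simp
  map_comp {i j k} s t := by
    rw [← cancel_mono (image.ι (colimit.ι M k)), Category.assoc, imMap_ι, imMap_ι,
      ← Category.assoc, imMap_ι, Category.assoc, Category.comp_id, Category.comp_id,
      Category.comp_id]

lemma kappaObj_mem (M : Λ ⥤ C) : filteredObjects Λ C (kappaObj M) := fun i j s => by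
  have h : (kappaObj M).map s ≫ image.ι (colimit.ι M j) = image.ι (colimit.ι M i) :=
    (imMap_ι _ _ _).trans (Category.comp_id _)
  have : Mono ((kappaObj M).map s ≫ image.ι (colimit.ι M j)) := h ▸
    inferInstanceAs (Mono (image.ι (colimit.ι M i)))
  exact mono_of_mono _ (image.ι (colimit.ι M j))

variable (Λ C) in
/-- The functor `κ : Fct(Λ, C) ⥤ F_Λ C`. -/
def kappa : (Λ ⥤ C) ⥤ Filt Λ C where
  obj M := ⟨kappaObj M, kappaObj_mem M⟩
  map {M N} f := ObjectProperty.homMk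
    { app := fun i => imMap (f.app i) (colimMap f) (by simp)
      naturality := fun i j s => by
        dsimp only [kappaObj]
        rw [← cancel_mono (image.ι (colimit.ι N j)), Category.assoc, Category.assoc,
          imMap_ι, imMap_ι, ← Category.assoc, ← Category.assoc, imMap_ι, imMap_ι,
          Category.comp_id, Category.comp_id] }
  map_id M := by
    ext i
    refine (cancel_mono (image.ι (colimit.ι M i))).1 ((imMap_ι _ _ _).trans ?_)
    have : colimMap (𝟙 M) = 𝟙 (colimit M) := by ext; simp
    rw [this]
    exact (Category.comp_id _).trans (Category.id_comp _).symm
  map_comp {M N P} f g := by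
    ext i
    refine (cancel_mono (image.ι (colimit.ι P i))).1 ((imMap_ι _ _ _).trans ?_)
    have : colimMap (f ≫ g) = colimMap f ≫ colimMap g := by ext; simp
    have h : imMap (f := colimit.ι M i) (g := colimit.ι N i) (f.app i) (colimMap f) (by simp) ≫
        imMap (f := colimit.ι N i) (g := colimit.ι P i) (g.app i) (colimMap g) (by simp) ≫
        image.ι (colimit.ι P i) = image.ι (colimit.ι M i) ≫ colimMap f ≫ colimMap g := by
      rw [imMap_ι, ← Category.assoc, imMap_ι, Category.assoc]
    rw [this, ← h]
    exact (Category.assoc _ _ _).symm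

/-- The canonical morphism `M ⟶ κ(M)`. -/
def toKappa (M : Λ ⥤ C) : M ⟶ kappaObj M where
  app i := factorThruImage (colimit.ι M i)
  naturality _ _ _ := (factorThruImage_imMap _ _ _).symm

instance (M : Λ ⥤ C) : Epi (toKappa M) :=
  have : ∀ i, Epi ((toKappa M).app i) := fun i =>
    inferInstanceAs (Epi (factorThruImage (colimit.ι M i)))
  NatTrans.epi_of_epi_app _

lemma toKappa_naturality {M N : Λ ⥤ C} (f : M ⟶ N) :
    f ≫ toKappa N = toKappa M ≫ ((kappa Λ C).map f).hom := by
  ext i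
  exact (factorThruImage_imMap _ _ _).symm

end Kappa

section Instances

variable {Λ : Type w} [SmallCategory Λ] {C : Type u} [Category.{v} C] [Abelian C]

instance filteredObjects_closedUnderLimits (J : Type) [SmallCategory J] [FinCategory J] :
    (filteredObjects Λ C).IsClosedUnderLimitsOfShape J where
  limitsOfShape_le := by
    rintro M ⟨p⟩
    intro i j s
    refine ⟨fun {Z} a b hab => ?_⟩
    refine (isLimitOfPreserves ((evaluation Λ C).obj i) p.isLimit).hom_ext fun k => ?_
    have := p.prop_diag_obj k s
    have hk : M.map s ≫ (p.π.app k).app j = (p.π.app k).app i ≫ (p.diag.obj k).map s :=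
      (p.π.app k).naturality s
    refine (cancel_mono ((p.diag.obj k).map s)).1 ?_
    change (a ≫ (p.π.app k).app i) ≫ _ = (b ≫ (p.π.app k).app i) ≫ _
    rw [Category.assoc, Category.assoc, ← hk, reassoc_of% hab]

instance : HasFiniteLimits (Filt Λ C) :=
  ⟨fun J _ _ => hasLimitsOfShape_of_closedUnderLimits J (filteredObjects Λ C)⟩

instance : HasZeroObject (Filt Λ C) := hasZeroObject_of_hasTerminal_object

instance : @HasBinaryBiproducts (Filt Λ C) _ Preadditive.preadditiveHasZeroMorphisms :=
  HasBinaryBiproducts.of_hasBinaryProducts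

instance : @HasKernels (Filt Λ C) _ Preadditive.preadditiveHasZeroMorphisms :=
  @HasKernels.mk _ _ Preadditive.preadditiveHasZeroMorphisms (fun _ => inferInstance)

variable [IsFiltered Λ] [HasColimitsOfSize.{w, w} C] [AB5OfSize.{w, w} C]

lemma mono_colimit_ι (M : Λ ⥤ C) (hM : filteredObjects Λ C M) (i : Λ) : Mono (colimit.ι M i) := by
  have : ∀ (j j' : Λ) (s : j ⟶ j'), Mono (M.map s) := fun _ _ s => hM s
  exact (colimit.isColimit M).mono_ι_app_of_isFiltered i

lemma isIso_toKappa (M : Filt Λ C) : IsIso (toKappa M.obj) := by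
  have : ∀ i, IsIso ((toKappa M.obj).app i) := fun i => by
    have := mono_colimit_ι M.obj M.property i
    have : Mono (factorThruImage (colimit.ι M.obj i) ≫ image.ι (colimit.ι M.obj i)) := by
      rwa [image.fac]
    have : Mono (factorThruImage (colimit.ι M.obj i)) := mono_of_mono _ (image.ι _)
    exact isIso_of_mono_of_epi (factorThruImage (colimit.ι M.obj i))
  exact NatIso.isIso_of_isIso_app _

/-- The isomorphism `M ≅ κ(ι(M))` for a filtered object `M`. -/
def toKappaIso (M : Filt Λ C) : M ≅ (kappa Λ C).obj M.obj :=
  (filteredObjects Λ C).isoMk (X := M) (Y := (kappa Λ C).obj M.obj)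
    (@asIso (Λ ⥤ C) _ M.obj (kappaObj M.obj) (toKappa M.obj) (isIso_toKappa M))

lemma toKappaIso_hom_hom (M : Filt Λ C) : (toKappaIso M).hom.hom = toKappa M.obj := rfl

variable (Λ C) in
/-- The functor `κ` is left adjoint to the inclusion of filtered objects. -/
def kappaAdj : kappa Λ C ⊣ incl Λ C where
  unit :=
    { app := fun M => toKappa M
      naturality := fun _ _ f => toKappa_naturality f }
  counit :=
    { app := fun M => (toKappaIso M).inv
      naturality := fun M N f => by
        refine (Iso.comp_inv_eq _).2 ?_
        rw [Category.assoc, Iso.eq_inv_comp]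
        refine ObjectProperty.hom_ext _ ?_
        exact (toKappa_naturality f.hom).symm }
  left_triangle_components M := by
    refine (Iso.comp_inv_eq _).2 ?_
    rw [Category.id_comp]
    refine ObjectProperty.hom_ext _ ((cancel_epi (toKappa M)).1 ?_)
    exact (toKappa_naturality (toKappa M)).symm
  right_triangle_components M := congrArg InducedCategory.Hom.hom (toKappaIso M).hom_inv_id

instance : (kappa Λ C).Additive := (kappaAdj Λ C).left_adjoint_additive

instance : @HasCokernels (Filt Λ C) _ Preadditive.preadditiveHasZeroMorphisms :=
  have : Reflective (incl Λ C) := { L := kappa Λ C, adj := kappaAdj Λ C }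
  have := hasColimitsOfShape_of_reflective (J := WalkingParallelPair) (incl Λ C)
  @HasCokernels.mk _ _ Preadditive.preadditiveHasZeroMorphisms (fun _ => inferInstance)

end Instances

end FilteredObj

end

/-! Write `A` for the functor category `Λ ⥤ C`. Filtered objects form a full reflective subcategory
of `A`, closed under subobjects, and everything follows from two facts about it.

The inclusion both preserves and detects strict exactness (`isStrictlyExact_iff_exact_incl`). As a
right adjoint it preserves kernels, and it sends cokernel projections to epimorphisms, because the
image in `A` of such a projection is already filtered. AB5 enters here through the adjunction: it
makes `M(i) ⟶ colim M` a monomorphism for filtered `M`, so that `κ` restricts to the identity on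
filtered objects.

Every functor `M` has a functorial resolution `0 ⟶ N ⟶ P ⟶ M ⟶ 0` by filtered objects, with `P(i)`
the coproduct of the `M(j)` for `j ≤ i` (`shortResolution`). Hence a complex `K` in `A` is
functorially quasi-isomorphic to the cone of `N(K) ⟶ P(K)`, a complex of filtered objects with the
same kind of bound as `K`.

The rest is formal. A fully faithful functor with functorial left resolutions becomes an equivalence
after localization (`isLocalizedEquivalence_of_functorial_leftResolutions`). Since `κ ι` is the
identity, `κ` inverts quasi-isomorphisms between filtered complexes, so evaluating it on the cones
gives `Lκ` (`exists_isLeftDerivedFunctor`), a quasi-inverse of `ι`. Strict exactness in a given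
degree is also respected both ways, so the left heart of filtered objects corresponds to that of
`A`, which is `A` in degree `0`. -/

noncomputable section

namespace StrictExact

/-! ### Strict exactness as a single isomorphism condition -/

section

variable {C : Type u} [Category.{v} C] [Preadditive C] [HasKernels C] [HasCokernels C]

/-- The canonical morphism from the coimage of the first morphism of a sequence to the kernel
of the second one. -/
def coimageToKernel (S : ShortComplex C) : Abelian.coimage S.f ⟶ kernel S.g :=
  Abelian.coimageImageComparison S.f ≫
    kernel.lift S.g (Abelian.image.ι S.f) (image_ι_comp_eq_zero S)

lemma π_coimageToKernel_ι (S : ShortComplex C) :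
    Abelian.coimage.π S.f ≫ coimageToKernel S ≫ kernel.ι S.g = S.f := by
  simp [coimageToKernel]

lemma π_coimageToKernel (S : ShortComplex C) :
    Abelian.coimage.π S.f ≫ coimageToKernel S = kernel.lift S.g S.f S.zero := by
  rw [← cancel_mono (kernel.ι S.g), Category.assoc, π_coimageToKernel_ι, kernel.lift_ι]

/-- The map `im f ⟶ ker g` is always a monomorphism. If the composite from the coimage is
invertible, this map is also a split epimorphism, so both factors are isomorphisms. -/
lemma isStrictlyExact_iff_isIso_coimageToKernel (S : ShortComplex C) :
    IsStrictlyExact S ↔ IsIso (coimageToKernel S) := by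
  constructor
  · rintro ⟨h₁, h₂⟩
    have : IsIso (Abelian.coimageImageComparison S.f) := h₁
    exact IsIso.comp_isIso
  · intro h
    have : Mono (kernel.lift S.g (Abelian.image.ι S.f) (image_ι_comp_eq_zero S)) :=
      mono_of_mono_fac (kernel.lift_ι S.g _ (image_ι_comp_eq_zero S))
    have : IsSplitEpi (kernel.lift S.g (Abelian.image.ι S.f) (image_ι_comp_eq_zero S)) :=
      ⟨⟨⟨inv (coimageToKernel S) ≫ Abelian.coimageImageComparison S.f, by
        rw [Category.assoc]
        exact IsIso.inv_hom_id (coimageToKernel S)⟩⟩⟩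
    have h₂ : IsIso (kernel.lift S.g (Abelian.image.ι S.f) (image_ι_comp_eq_zero S)) :=
      isIso_of_mono_of_isSplitEpi _
    exact ⟨IsIso.of_isIso_fac_right (h := coimageToKernel S) rfl, h₂⟩

end

/-! ### Comparison with exactness in an abelian category -/

section Abelian

variable {A : Type u} [Category.{v} A] [Abelian A]

lemma isStrictlyExact_iff_exact (S : ShortComplex A) : IsStrictlyExact S ↔ S.Exact := by
  rw [ShortComplex.exact_iff_epi_kernel_lift, ← π_coimageToKernel,
    isStrictlyExact_iff_isIso_coimageToKernel]
  have : Mono (coimageToKernel S) := mono_comp _ _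
  constructor
  · intro h
    infer_instance
  · intro h
    have := epi_of_epi (Abelian.coimage.π S.f) (coimageToKernel S)
    exact isIso_of_mono_of_epi _

lemma isStrictlyExactAt_iff_exactAt (K : CochainComplex A ℤ) (n : ℤ) :
    IsStrictlyExactAt K n ↔ K.ExactAt n := by
  rw [IsStrictlyExactAt, isStrictlyExact_iff_exact,
    K.exactAt_iff' (n - 1) n (n + 1) (by simp) (by simp)]

lemma strictlyExactComplexes_eq_subcategoryAcyclic :
    strictlyExactComplexes (C := A) = HomotopyCategory.subcategoryAcyclic A := by
  ext X
  obtain ⟨K, rfl⟩ := HomotopyCategory.quotient_obj_surjective X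
  rw [HomotopyCategory.quotient_obj_mem_subcategoryAcyclic_iff_exactAt]
  exact forall_congr' fun n => isStrictlyExactAt_iff_exactAt K n

lemma qis_eq_inverseImage_quasiIso (s : Bound) :
    qis A s = (HomotopyCategory.quasiIso A (ComplexShape.up ℤ)).inverseImage (bounded A s).ι := by
  rw [HomotopyCategory.quasiIso_eq_trW_subcategoryAcyclic,
    ← strictlyExactComplexes_eq_subcategoryAcyclic, qis]

variable {F : Type u'} [Category.{v'} F] [Preadditive F] [HasKernels F] [HasCokernels F]
  (I : F ⥤ A) [I.Additive] [PreservesFiniteLimits I]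

/-- An element of `I(coim f)` that dies in `I(ker g)` lifts, after refinement, to `I(X₁)`. The lift
is killed by `I(f)`, hence comes from `I(ker f)` because `I` preserves kernels, and so vanishes in
the coimage. -/
lemma mono_map_coimageToKernel (hI : ∀ ⦃X Y : F⦄ (f : X ⟶ Y), Epi (I.map (cokernel.π f)))
    (S : ShortComplex F) : Mono (I.map (coimageToKernel S)) := by
  have : Epi (I.map (Abelian.coimage.π S.f)) := hI _
  rw [Preadditive.mono_iff_cancel_zero]
  intro T x hx
  obtain ⟨T', q, _, x', hx'⟩ := surjective_up_to_refinements_of_epi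
    (I.map (Abelian.coimage.π S.f)) x
  have h₁ : x' ≫ I.map S.f = 0 := by
    rw [← π_coimageToKernel_ι S, Functor.map_comp, Functor.map_comp, ← reassoc_of% hx',
      reassoc_of% hx, zero_comp, comp_zero]
  obtain ⟨l, hl⟩ : ∃ l, l ≫ I.map (kernel.ι S.f) = x' :=
    ⟨kernel.lift _ x' h₁ ≫ inv (kernelComparison S.f I), by
      rw [Category.assoc, IsIso.inv_comp_eq _ |>.2 (kernelComparison_comp_ι S.f I).symm,
        kernel.lift_ι]⟩
  rw [← cancel_epi q, hx', ← hl, Category.assoc, ← I.map_comp]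
  have : kernel.ι S.f ≫ Abelian.coimage.π S.f = 0 := cokernel.condition _
  rw [this, I.map_zero, comp_zero, comp_zero]

/-- Strict exactness is exactness in `A` for a subcategory of `A` that is closed under kernels and
whose cokernel projections are epimorphisms of `A`. -/
lemma isStrictlyExact_iff_exact_map [I.ReflectsIsomorphisms]
    (hI : ∀ ⦃X Y : F⦄ (f : X ⟶ Y), Epi (I.map (cokernel.π f))) (S : ShortComplex F) :
    IsStrictlyExact S ↔ (S.map I).Exact := by
  have hπ : Epi (I.map (Abelian.coimage.π S.f)) := hI _
  have hι := mono_map_coimageToKernel I hI S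
  have hS : I.map S.f ≫ I.map S.g = 0 := (S.map I).zero
  -- The first factor is an epimorphism and the last an isomorphism, so exactness of the image
  -- sequence says exactly that the middle factor, already mono, is epi.
  have hker : kernel.lift (I.map S.g) (I.map S.f) hS =
      I.map (Abelian.coimage.π S.f) ≫ I.map (coimageToKernel S) ≫ kernelComparison S.g I := by
    rw [← cancel_mono (kernel.ι _), kernel.lift_ι, Category.assoc, Category.assoc,
      kernelComparison_comp_ι, ← I.map_comp, ← I.map_comp, π_coimageToKernel_ι]
  have : (S.map I).Exact ↔ Epi (kernel.lift (I.map S.g) (I.map S.f) hS) :=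
    ShortComplex.exact_iff_epi_kernel_lift _
  rw [this, hker, isStrictlyExact_iff_isIso_coimageToKernel]
  constructor
  · intro h
    infer_instance
  · intro h
    have := epi_of_epi (I.map (Abelian.coimage.π S.f))
      (I.map (coimageToKernel S) ≫ kernelComparison S.g I)
    have : Epi (I.map (coimageToKernel S)) :=
      (epi_comp_iff_of_isIso _ (kernelComparison S.g I)).1 this
    have := isIso_of_mono_of_epi (I.map (coimageToKernel S))
    exact isIso_of_reflects_iso _ I

end Abelian

end StrictExact

/-! ### The inclusion of filtered objects detects strict exactness -/

namespace FilteredObj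

open StrictExact

variable {Λ : Type w} [SmallCategory Λ] {C : Type u} [Category.{v} C] [Abelian C]

lemma filteredObjects_of_mono {M N : Λ ⥤ C} (f : M ⟶ N) [Mono f] (hN : filteredObjects Λ C N) :
    filteredObjects Λ C M := fun i j s => by
  have := hN s
  have : Mono (M.map s ≫ f.app j) := by
    rw [f.naturality]
    infer_instance
  exact mono_of_mono _ (f.app j)

variable [IsFiltered Λ] [HasColimitsOfSize.{w, w} C] [AB5OfSize.{w, w} C]

instance : PreservesFiniteLimits (incl Λ C) :=
  ⟨fun _ _ _ => ((kappaAdj Λ C).rightAdjoint_preservesLimits.{0, 0}).preservesLimitsOfShape⟩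

/-- The cokernel projections of filtered objects are epimorphisms of functors. -/
lemma epi_incl_map_cokernel_π {X Y : Filt Λ C} (f : X ⟶ Y) :
    Epi ((incl Λ C).map (cokernel.π f)) := by
  let π := (incl Λ C).map (cokernel.π f)
  -- The image of the projection is filtered, being a subobject of a filtered object, and the map
  -- onto it kills `f`. The universal property of the cokernel then splits the monomorphism `m`, so
  -- the image is everything.
  let J : Filt Λ C := ⟨image π, filteredObjects_of_mono (image.ι π) (cokernel f).property⟩
  let q : Y ⟶ J := ObjectProperty.homMk (factorThruImage π)
  let m : J ⟶ cokernel f := ObjectProperty.homMk (image.ι π)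
  have hqm : q ≫ m = cokernel.π f := ObjectProperty.hom_ext _ (image.fac π)
  have : Mono m := (incl Λ C).mono_of_mono_map (inferInstanceAs (Mono (image.ι π)))
  have hfq : f ≫ q = 0 := by
    rw [← cancel_mono m, Category.assoc, hqm, cokernel.condition, zero_comp]
  have : IsIso m := @isIso_of_mono_of_isSplitEpi _ _ _ _ m _ <| ⟨⟨⟨cokernel.desc f q hfq, by
    rw [← cancel_epi (cokernel.π f), cokernel.π_desc_assoc, hqm, Category.comp_id]⟩⟩⟩
  have : IsIso (image.ι π) := Functor.map_isIso (incl Λ C) m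
  have : Epi (factorThruImage π ≫ image.ι π) := epi_comp _ _
  rwa [image.fac] at this

lemma isStrictlyExact_iff_exact_incl (S : ShortComplex (Filt Λ C)) :
    IsStrictlyExact S ↔ (S.map (incl Λ C)).Exact :=
  isStrictlyExact_iff_exact_map (incl Λ C) (fun _ _ f => epi_incl_map_cokernel_π f) S

end FilteredObj

namespace StrictExact

/-! ### Localization and derived functors from functorial left resolutions -/

section Localization

variable {C₁ : Type*} [Category* C₁] {C₂ : Type*} [Category* C₂]
  {W₁ : MorphismProperty C₁} {W₂ : MorphismProperty C₂} (Φ : LocalizerMorphism W₁ W₂)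
  {ρ : C₂ ⥤ C₁} (p : ρ ⋙ Φ.functor ⟶ 𝟭 C₂) (hp : ∀ X, W₂ (p.app X))
  (hW : W₁ = W₂.inverseImage Φ.functor)

include hp hW in
-- Two-out-of-three in the naturality square of `p` at `f`.
lemma map_mem_of_functorial_leftResolutions [W₂.HasTwoOutOfThreeProperty] {X Y : C₂} (f : X ⟶ Y)
    (hf : W₂ f) : W₁ (ρ.map f) := by
  rw [hW]
  refine (W₂.postcomp_iff _ _ (hp Y)).1 ?_
  have h := p.naturality f
  dsimp at h
  rw [h]
  exact W₂.comp_mem _ _ (hp X) hf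

/-- The natural transformation on the source category of a fully faithful functor that is
deduced from functorial left resolutions. -/
def counitOfLeftResolutions [Φ.functor.Full] [Φ.functor.Faithful] : Φ.functor ⋙ ρ ⟶ 𝟭 C₁ :=
  ((Functor.whiskeringRight C₁ C₁ C₂).obj Φ.functor).preimage
    (X := Φ.functor ⋙ ρ) (Y := 𝟭 C₁) (Functor.whiskerLeft Φ.functor p)

lemma functor_map_counitOfLeftResolutions_app [Φ.functor.Full] [Φ.functor.Faithful] (X : C₁) :
    Φ.functor.map ((counitOfLeftResolutions Φ p).app X) = p.app (Φ.functor.obj X) :=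
  NatTrans.congr_app (((Functor.whiskeringRight C₁ C₁ C₂).obj Φ.functor).map_preimage
    (X := Φ.functor ⋙ ρ) (Y := 𝟭 C₁) (Functor.whiskerLeft Φ.functor p)) X

variable [Φ.functor.Full] [Φ.functor.Faithful]

include hp hW

lemma counitOfLeftResolutions_mem (X : C₁) : W₁ ((counitOfLeftResolutions Φ p).app X) := by
  refine hW.ge _ ?_
  change W₂ (Φ.functor.map _)
  rw [functor_map_counitOfLeftResolutions_app]
  exact hp _

variable [W₂.HasTwoOutOfThreeProperty]

/-- A fully faithful functor along which the weak equivalences are induced and for which there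
are functorial left resolutions is a localized equivalence. -/
lemma isLocalizedEquivalence_of_functorial_leftResolutions : Φ.IsLocalizedEquivalence where
  isEquivalence := by
    let Ψ : LocalizerMorphism W₂ W₁ :=
      { functor := ρ
        map := fun _ _ f hf => map_mem_of_functorial_leftResolutions Φ p hp hW f hf }
    let : Localization.Lifting W₂.Q W₂ (ρ ⋙ W₁.Q) (Ψ.localizedFunctor W₂.Q W₁.Q) :=
      Ψ.liftingLocalizedFunctor _ _
    have : IsIso (Functor.whiskerRight (counitOfLeftResolutions Φ p) W₁.Q) := by
      rw [NatTrans.isIso_iff_isIso_app]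
      exact fun _ => Localization.inverts W₁.Q W₁ _ (counitOfLeftResolutions_mem Φ p hp hW _)
    have : IsIso (Functor.whiskerRight p W₂.Q) := by
      rw [NatTrans.isIso_iff_isIso_app]
      exact fun _ => Localization.inverts W₂.Q W₂ _ (hp _)
    refine (Localization.equivalence W₁.Q W₁ W₂.Q W₂ (Φ.functor ⋙ W₂.Q)
      (Φ.localizedFunctor W₁.Q W₂.Q)
      (ρ ⋙ W₁.Q) (Ψ.localizedFunctor W₂.Q W₁.Q) ?_ ?_).isEquivalence_functor
    · exact Functor.associator _ _ _ ≪≫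
        Functor.isoWhiskerLeft _ (Ψ.catCommSq W₂.Q W₁.Q).iso.symm ≪≫
        (Functor.associator _ _ _).symm ≪≫
        asIso (Functor.whiskerRight (counitOfLeftResolutions Φ p) W₁.Q) ≪≫ Functor.leftUnitor _
    · exact Functor.associator _ _ _ ≪≫
        Functor.isoWhiskerLeft _ (CatCommSq.iso Φ.functor W₁.Q W₂.Q _).symm ≪≫
        (Functor.associator _ _ _).symm ≪≫
        asIso (Functor.whiskerRight p W₂.Q) ≪≫ Functor.leftUnitor _

variable {D₂ : Type*} [Category* D₂] (L : C₂ ⥤ D₂) [L.IsLocalization W₂]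
  {H : Type*} [Category* H] (F : C₂ ⥤ H) (hF : W₁.IsInvertedBy (Φ.functor ⋙ F))

include hF

/-- With functorial left resolutions by objects of a full subcategory on which a functor `F`
inverts the weak equivalences, `F` has a left derived functor, and the comparison morphism from it
to `F` is an isomorphism on the subcategory. -/
lemma exists_isLeftDerivedFunctor :
    ∃ (LF : D₂ ⥤ H) (α : L ⋙ LF ⟶ F), LF.IsLeftDerivedFunctor α W₂ ∧
      ∀ X : C₁, IsIso (α.app (Φ.functor.obj X)) := by
  have hR : W₂.IsInvertedBy (ρ ⋙ Φ.functor ⋙ F) := fun X Y f hf =>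
    hF _ (map_mem_of_functorial_leftResolutions Φ p hp hW f hf)
  let LF := Localization.lift (ρ ⋙ Φ.functor ⋙ F) hR L
  let e : L ⋙ LF ≅ ρ ⋙ Φ.functor ⋙ F := Localization.fac _ hR L
  let q : ρ ⋙ Φ.functor ⋙ F ⟶ F :=
    { app := fun X => F.map (p.app X)
      naturality := fun X Y f => by
        have h := p.naturality f
        dsimp at h ⊢
        rw [← F.map_comp, ← F.map_comp, h] }
  have hq : ∀ X : C₁, IsIso (F.map (p.app (Φ.functor.obj X))) := fun X => by
    rw [← functor_map_counitOfLeftResolutions_app]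
    exact hF _ (counitOfLeftResolutions_mem Φ p hp hW X)
  have hα : ∀ X : C₁, IsIso ((e.hom ≫ q).app (Φ.functor.obj X)) := fun X => by
    rw [NatTrans.comp_app]
    exact IsIso.comp_isIso' inferInstance (hq X)
  refine ⟨LF, e.hom ≫ q, ?_, hα⟩
  rw [Functor.isLeftDerivedFunctor_iff_isRightKanExtension]
  have hLp : ∀ X, IsIso (L.map (p.app X)) := fun X => Localization.inverts L W₂ _ (hp X)
  have key : ∀ (G : D₂ ⥤ H) (β : L ⋙ G ⟶ F),
      ∃! γ : G ⟶ LF, Functor.whiskerLeft L γ ≫ e.hom ≫ q = β := by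
    intro G β
    -- Naturality of `β` at `p X` writes `β X` as the inverse of `G(L(p X))`, then `β` at the
    -- resolution, then `F(p X)`. Dropping the last factor, which is `q`, gives the lift.
    let γ' : L ⋙ G ⟶ L ⋙ LF :=
      { app := fun X => inv (G.map (L.map (p.app X))) ≫ β.app (Φ.functor.obj (ρ.obj X)) ≫
          e.inv.app X
        naturality := fun X Y f => by
          have h₁ := p.naturality f
          have h₂ := β.naturality (Φ.functor.map (ρ.map f))
          have h₃ := e.inv.naturality f
          dsimp at h₁ h₂ h₃ ⊢
          rw [← cancel_epi (G.map (L.map (p.app X))), Category.assoc, Category.assoc,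
            IsIso.hom_inv_id_assoc, ← G.map_comp_assoc, ← L.map_comp, ← h₁, L.map_comp,
            G.map_comp_assoc, IsIso.hom_inv_id_assoc, reassoc_of% h₂, h₃] }
    let γ : G ⟶ LF := Localization.liftNatTrans L W₂ (L ⋙ G) (L ⋙ LF) G LF γ'
    have hγ : ∀ X, γ.app (L.obj X) = γ'.app X := fun X => by
      simp [γ, Localization.liftNatTrans_app, Localization.Lifting.iso]
    have hγ' : Functor.whiskerLeft L γ ≫ e.hom ≫ q = β := by
      ext X
      have h := β.naturality (p.app X)
      dsimp at h
      simp [hγ, γ', q, ← h]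
    refine ⟨γ, hγ', ?_⟩
    intro δ hδ
    refine Localization.natTrans_ext L W₂ fun X => ?_
    -- A lift is determined on objects coming from `C₁`, where the comparison with `F` is
    -- invertible, and `L` makes every object isomorphic to one of these through `p`.
    have hι (Y : C₁) : δ.app (L.obj (Φ.functor.obj Y)) = γ.app (L.obj (Φ.functor.obj Y)) := by
      have := hα Y
      rw [← cancel_mono ((e.hom ≫ q).app (Φ.functor.obj Y))]
      exact NatTrans.congr_app (hδ.trans hγ'.symm) (Φ.functor.obj Y)
    have h₁ := δ.naturality (L.map (p.app X))
    have h₂ := γ.naturality (L.map (p.app X))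
    dsimp at h₁ h₂
    rw [← cancel_epi (G.map (L.map (p.app X)))]
    exact h₁.trans ((congr_arg (· ≫ LF.map (L.map (p.app X))) (hι (ρ.obj X))).trans h₂.symm)
  exact ⟨⟨IsTerminal.ofUniqueHom
    (fun E => CostructuredArrow.homMk (key E.left E.hom).choose (key E.left E.hom).choose_spec.1)
    (fun E m => by
      ext1
      exact (key E.left E.hom).choose_spec.2 _ (CostructuredArrow.w m))⟩⟩

end Localization

/-! ### Resolving complexes by mapping cones -/

open CochainComplex

variable {A : Type u} [Category.{v} A] [Abelian A]
  {F : Type u'} [Category.{v'} F] [Preadditive F]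

/-- Functorial resolutions `0 ⟶ I(N X) ⟶ I(P X) ⟶ X ⟶ 0` of length one by objects in the image of
an additive functor `I`. -/
structure ShortResolution (I : F ⥤ A) where
  /-- The resolving object. -/
  P : A ⥤ F
  /-- The kernel. -/
  N : A ⥤ F
  [additive_P : P.Additive]
  [additive_N : N.Additive]
  /-- The projection. -/
  p : P ⋙ I ⟶ 𝟭 A
  /-- The inclusion of the kernel. -/
  j : N ⟶ P
  zero (X : A) : I.map (j.app X) ≫ p.app X = 0
  shortExact (X : A) : (ShortComplex.mk _ _ (zero X)).ShortExact

section

omit [Abelian A] in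
lemma mappingCone_map_f_snd_v [Preadditive A] [HasBinaryBiproducts A]
    {K₁ L₁ K₂ L₂ : CochainComplex A ℤ} (φ₁ : K₁ ⟶ L₁)
    (φ₂ : K₂ ⟶ L₂) (a : K₁ ⟶ K₂) (b : L₁ ⟶ L₂) (comm : φ₁ ≫ b = a ≫ φ₂) (n : ℤ) :
    (mappingCone.map φ₁ φ₂ a b comm).f n ≫ (mappingCone.snd φ₂).v n n (add_zero n) =
      (mappingCone.snd φ₁).v n n (add_zero n) ≫ b.f n := by
  simp [mappingCone.ext_from_iff _ (n + 1) n rfl, mappingCone.map]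

lemma mapHomologicalComplexIso_hom_f_snd_v [HasBinaryBiproducts F] (I : F ⥤ A) [I.Additive]
    {K L : CochainComplex F ℤ} (φ : K ⟶ L) (n : ℤ) :
    (mappingCone.mapHomologicalComplexIso φ I).hom.f n ≫
      (mappingCone.snd _).v n n (add_zero n) =
        I.map ((mappingCone.snd φ).v n n (add_zero n)) := by
  let φ' := (I.mapHomologicalComplex (ComplexShape.up ℤ)).map φ
  have h : (mappingCone.mapHomologicalComplexIso φ I).hom.f n =
      (show ((I.mapHomologicalComplex (ComplexShape.up ℤ)).obj (mappingCone φ)).X n ⟶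
          ((I.mapHomologicalComplex (ComplexShape.up ℤ)).obj K).X (n + 1) from
        I.map ((mappingCone.fst φ).1.v n (n + 1) rfl)) ≫
          (mappingCone.inl φ').v (n + 1) n (by lia) +
      (show ((I.mapHomologicalComplex (ComplexShape.up ℤ)).obj (mappingCone φ)).X n ⟶
          ((I.mapHomologicalComplex (ComplexShape.up ℤ)).obj L).X n from
        I.map ((mappingCone.snd φ).v n n (add_zero n))) ≫ (mappingCone.inr φ').f n := rfl
  rw [h, Preadditive.add_comp, Category.assoc, Category.assoc, mappingCone.inl_v_snd_v,
    mappingCone.inr_f_snd_v, comp_zero, zero_add]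
  exact Category.comp_id _

end

namespace ShortResolution

attribute [instance] additive_P additive_N

variable {I : F ⥤ A} [I.Additive] (R : ShortResolution I)

/-- The inclusion of kernels, on complexes. -/
abbrev jComplex (K : CochainComplex A ℤ) :
    (R.N.mapHomologicalComplex (ComplexShape.up ℤ)).obj K ⟶
      (R.P.mapHomologicalComplex (ComplexShape.up ℤ)).obj K :=
  (NatTrans.mapHomologicalComplex R.j (ComplexShape.up ℤ)).app K

/-- The projection, on complexes. -/
def pComplex (K : CochainComplex A ℤ) :
    (I.mapHomologicalComplex (ComplexShape.up ℤ)).obj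
      ((R.P.mapHomologicalComplex (ComplexShape.up ℤ)).obj K) ⟶ K where
  f n := R.p.app (K.X n)
  comm' m n _ := (R.p.naturality (K.d m n)).symm

/-- The short exact sequence of complexes given by the resolutions of the terms of a complex. -/
abbrev shortComplex (K : CochainComplex A ℤ) : ShortComplex (CochainComplex A ℤ) where
  f := (I.mapHomologicalComplex (ComplexShape.up ℤ)).map (R.jComplex K)
  g := R.pComplex K
  zero := by
    ext n
    exact R.zero (K.X n)

lemma shortExact_shortComplex (K : CochainComplex A ℤ) : (R.shortComplex K).ShortExact :=
  HomologicalComplex.shortExact_of_degreewise_shortExact _ fun n => R.shortExact (K.X n)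

variable [HasZeroObject F] [HasBinaryBiproducts F]

/-- The functor which sends a complex `K` to the mapping cone of `N(K) ⟶ P(K)`. -/
def cone : CochainComplex A ℤ ⥤ CochainComplex F ℤ where
  obj K := mappingCone (R.jComplex K)
  map f := mappingCone.map _ _ ((R.N.mapHomologicalComplex _).map f)
    ((R.P.mapHomologicalComplex _).map f) (by simp)
  map_id K := by
    rw [← mappingCone.map_id]
    congr 1 <;> simp
  map_comp f g := by
    rw [← mappingCone.map_comp]
    congr 1 <;> simp

/-- The resolution of a complex `K` by the mapping cone of `N(K) ⟶ P(K)`. -/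
def conePApp (K : CochainComplex A ℤ) :
    (I.mapHomologicalComplex (ComplexShape.up ℤ)).obj (R.cone.obj K) ⟶ K :=
  (mappingCone.mapHomologicalComplexIso (R.jComplex K) I).hom ≫
    mappingCone.descShortComplex (R.shortComplex K)

omit [HasZeroObject F] in
-- The resolution vanishes on the summand `I(N(K^{n+1}))` of the cone. Naturality of `coneP` thus
-- reduces to naturality of `p` in each degree.
lemma conePApp_f (K : CochainComplex A ℤ) (n : ℤ) :
    (R.conePApp K).f n =
      I.map ((mappingCone.snd (R.jComplex K)).v n n (add_zero n)) ≫ (R.pComplex K).f n := by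
  have h : (mappingCone.descShortComplex (R.shortComplex K)).f n =
      (mappingCone.snd _).v n n (add_zero n) ≫ (R.pComplex K).f n := by
    simp [mappingCone.descShortComplex, mappingCone.desc_f _ _ _ _ n (n + 1) rfl]
  refine (congr_arg (_ ≫ ·) h).trans ((Category.assoc _ _ _).symm.trans ?_)
  exact congr_arg (· ≫ (R.pComplex K).f n) (mapHomologicalComplexIso_hom_f_snd_v I _ n)

instance (K : CochainComplex A ℤ) : QuasiIso (R.conePApp K) :=
  have := mappingCone.quasiIso_descShortComplex (R.shortExact_shortComplex K)
  quasiIso_comp (mappingCone.mapHomologicalComplexIso (R.jComplex K) I).hom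
    (mappingCone.descShortComplex (R.shortComplex K))

/-- The resolution of complexes, as a natural transformation. -/
def coneP : R.cone ⋙ I.mapHomologicalComplex (ComplexShape.up ℤ) ⟶ 𝟭 _ where
  app K := R.conePApp K
  naturality K L f := by
    ext n
    have h := mappingCone_map_f_snd_v _ _ ((R.N.mapHomologicalComplex _).map f)
        ((R.P.mapHomologicalComplex _).map f)
        ((NatTrans.mapHomologicalComplex R.j _).naturality f).symm n
    have h' : I.map (((R.P.mapHomologicalComplex (ComplexShape.up ℤ)).map f).f n) ≫
        (R.pComplex L).f n = (R.pComplex K).f n ≫ f.f n := R.p.naturality (f.f n)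
    refine (congr_arg₂ (· ≫ ·) rfl (R.conePApp_f L n)).trans ?_
    refine Eq.trans ?_ (congr_arg (· ≫ f.f n) (R.conePApp_f K n)).symm
    refine (Category.assoc _ _ _).symm.trans ?_
    refine (congr_arg (· ≫ (R.pComplex L).f n) ((I.map_comp _ _).symm.trans
      ((congr_arg I.map h).trans (I.map_comp _ _)))).trans ?_
    exact (Category.assoc _ _ _).trans ((congr_arg _ h').trans (Category.assoc _ _ _).symm)

omit [I.Additive] in
-- Both `N` and `P` are additive, so they preserve homotopy equivalences; the five lemma for the
-- cone triangles gives the third isomorphism. This is what lets `cone` descend to homotopy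
-- categories, since a functor inverting homotopy equivalences identifies homotopic maps.
lemma inverts_homotopyEquivalences :
    (HomologicalComplex.homotopyEquivalences A (ComplexShape.up ℤ)).IsInvertedBy
      (R.cone ⋙ HomotopyCategory.quotient F (ComplexShape.up ℤ)) := by
  intro K L f hf
  have h₁ : IsIso ((HomotopyCategory.quotient A (ComplexShape.up ℤ)).map f) :=
    HomotopyCategory.quotient_inverts_homotopyEquivalences A _ f hf
  have hN : IsIso ((R.N.mapHomotopyCategory (ComplexShape.up ℤ)).map
    ((HomotopyCategory.quotient A (ComplexShape.up ℤ)).map f)) := inferInstance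
  have hP : IsIso ((R.P.mapHomotopyCategory (ComplexShape.up ℤ)).map
    ((HomotopyCategory.quotient A (ComplexShape.up ℤ)).map f)) := inferInstance
  let φ := (HomotopyCategory.quotient F (ComplexShape.up ℤ)).mapTriangle.map
    (mappingCone.triangleMap (R.jComplex K) (R.jComplex L)
      ((R.N.mapHomologicalComplex _).map f) ((R.P.mapHomologicalComplex _).map f) (by simp))
  exact Pretriangulated.isIso₃_of_isIso₁₂ φ
    (HomotopyCategory.mappingCone_triangleh_distinguished _)
    (HomotopyCategory.mappingCone_triangleh_distinguished _) hN hP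

/-- The resolution functor on homotopy categories. -/
def coneh : HomotopyCategory A (ComplexShape.up ℤ) ⥤ HomotopyCategory F (ComplexShape.up ℤ) :=
  CategoryTheory.Quotient.lift _ (R.cone ⋙ HomotopyCategory.quotient F (ComplexShape.up ℤ))
    fun _ _ _ _ ⟨h⟩ => h.map_eq_of_inverts_homotopyEquivalences (fun n => ⟨n - 1, by simp⟩) _
      R.inverts_homotopyEquivalences

/-- The resolutions on homotopy categories. -/
def conehP : R.coneh ⋙ I.mapHomotopyCategory (ComplexShape.up ℤ) ⟶ 𝟭 _ :=
  Quotient.natTransLift _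
    (Functor.whiskerRight R.coneP (HomotopyCategory.quotient A (ComplexShape.up ℤ)))

lemma quasiIso_conehP_app (X : HomotopyCategory A (ComplexShape.up ℤ)) :
    HomotopyCategory.quasiIso A (ComplexShape.up ℤ) (R.conehP.app X) := by
  obtain ⟨K, rfl⟩ := HomotopyCategory.quotient_obj_surjective X
  exact (HomotopyCategory.quotient_map_mem_quasiIso_iff (R.conePApp K)).2
    (inferInstanceAs (QuasiIso (R.conePApp K)))

omit [HasZeroObject F] in
lemma isZero_mappingCone_X {K L : CochainComplex F ℤ} (f : K ⟶ L) (n : ℤ)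
    (hK : IsZero (K.X (n + 1))) (hL : IsZero (L.X n)) : IsZero ((mappingCone f).X n) := by
  rw [IsZero.iff_id_eq_zero, mappingCone.ext_from_iff _ (n + 1) n rfl]
  exact ⟨hK.eq_of_src _ _, hL.eq_of_src _ _⟩

omit [I.Additive] [HasZeroObject F] in
lemma isZero_cone_obj_X (K : CochainComplex A ℤ) (n : ℤ)
    (h : IsZero (K.X (n + 1))) (h' : IsZero (K.X n)) : IsZero ((R.cone.obj K).X n) :=
  isZero_mappingCone_X _ _ (R.N.map_isZero h) (R.P.map_isZero h')

omit [I.Additive] in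
lemma bounded_coneh (s : Bound) (X : HomotopyCategory A (ComplexShape.up ℤ)) (hX : bounded A s X) :
    bounded F s (R.coneh.obj X) := by
  cases s with
  | ub => trivial
  | b =>
    obtain ⟨N, hN⟩ := hX
    -- Degree `n` of the cone involves degrees `n` and `n + 1` of the complex, so two-sided and
    -- lower bounds move by one while an upper bound is kept.
    exact ⟨N + 1, fun n hn => R.isZero_cone_obj_X _ n (hN _ (by grind)) (hN _ (by grind))⟩
  | plus =>
    obtain ⟨N, hN⟩ := hX
    exact ⟨N - 1, fun n hn => R.isZero_cone_obj_X _ n (hN _ (by grind)) (hN _ (by grind))⟩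
  | minus =>
    obtain ⟨N, hN⟩ := hX
    exact ⟨N, fun n hn => R.isZero_cone_obj_X _ n (hN _ (by grind)) (hN _ (by grind))⟩

/-- The resolution functor on `K*`. -/
def coneStar (s : Bound) : KStar A s ⥤ KStar F s :=
  (bounded F s).lift ((bounded A s).ι ⋙ R.coneh) fun X => R.bounded_coneh s X.obj X.property

/-- The resolutions on `K*`. -/
def coneStarP (s : Bound) : R.coneStar s ⋙ mapKStar I s ⟶ 𝟭 (KStar A s) where
  app X := ObjectProperty.homMk (R.conehP.app X.obj)
  naturality _ _ f := ObjectProperty.hom_ext _ (R.conehP.naturality f.hom)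

lemma qis_coneStarP_app (s : Bound) (X : KStar A s) : qis A s ((R.coneStarP s).app X) := by
  rw [qis_eq_inverseImage_quasiIso]
  exact R.quasiIso_conehP_app X.obj

end ShortResolution
-- The equivalence of derived categories and the left derived functor
variable {A : Type u} [Category.{v} A] [Abelian A]
  {F : Type u'} [Category.{v'} F] [Preadditive F] [HasZeroObject F] [HasBinaryBiproducts F]
  [HasKernels F] [HasCokernels F]
  (I : F ⥤ A) [I.Additive]

/-- The functor `I` preserves and detects strict exactness. -/
def DetectsStrictExactness : Prop :=
  ∀ S : ShortComplex F, IsStrictlyExact S ↔ (S.map I).Exact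

variable {I}

omit [HasZeroObject F] [HasBinaryBiproducts F] in
lemma DetectsStrictExactness.isStrictlyExactFunctor (hI : DetectsStrictExactness I) :
    IsStrictlyExactFunctor I := fun S hS => (isStrictlyExact_iff_exact _).2 ((hI S).1 hS)

omit [HasZeroObject F] [HasBinaryBiproducts F] in
lemma DetectsStrictExactness.isStrictlyExactAt_iff (hI : DetectsStrictExactness I)
    (K : CochainComplex F ℤ) (n : ℤ) : IsStrictlyExactAt K n ↔
      IsStrictlyExactAt ((I.mapHomologicalComplex (ComplexShape.up ℤ)).obj K) n :=
  (hI _).trans (isStrictlyExact_iff_exact _).symm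

/-- `I` carries a cone of `f` to a cone of `I(f)` and detects strict exactness of it in every
degree. -/
lemma DetectsStrictExactness.qis_eq (hI : DetectsStrictExactness I) (s : Bound) :
    qis F s = (qis A s).inverseImage (mapKStar I s) := by
  refine le_antisymm (hI.isStrictlyExactFunctor.map_qis s) fun X Y f hf => ?_
  obtain ⟨Z, g, h, hT⟩ := Pretriangulated.distinguished_cocone_triangle f.hom
  refine (ObjectProperty.trW_iff _ _).2 ⟨Z, g, h, hT, ?_⟩
  have hT' := (I.mapHomotopyCategory (ComplexShape.up ℤ)).map_distinguished _ hT
  have hf' : (HomotopyCategory.subcategoryAcyclic A).trW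
      ((I.mapHomotopyCategory (ComplexShape.up ℤ)).map f.hom) := by
    rw [← strictlyExactComplexes_eq_subcategoryAcyclic]
    exact hf
  have hZ := ((HomotopyCategory.subcategoryAcyclic A).trW_iff_of_distinguished _ hT').1 hf'
  rw [← strictlyExactComplexes_eq_subcategoryAcyclic] at hZ
  exact fun n => (hI.isStrictlyExactAt_iff Z.as n).2 (hZ n)

instance : (HomotopyCategory.quasiIso A (ComplexShape.up ℤ)).HasTwoOutOfThreeProperty where
  comp_mem f g hf hg n := by
    have := hf n
    have := hg n
    rw [Functor.map_comp]
    infer_instance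
  of_postcomp f g hg hfg n := by
    have := hg n
    have := hfg n
    rw [Functor.map_comp] at this
    exact IsIso.of_isIso_comp_right _ ((HomotopyCategory.homologyFunctor A _ n).map g)
  of_precomp f g hf hfg n := by
    have := hf n
    have := hfg n
    rw [Functor.map_comp] at this
    exact IsIso.of_isIso_comp_left ((HomotopyCategory.homologyFunctor A _ n).map f) _

instance (s : Bound) : (qis A s).HasTwoOutOfThreeProperty := by
  rw [qis_eq_inverseImage_quasiIso]
  infer_instance

instance [I.Full] [I.Faithful] (s : Bound) : (mapKStar I s).Full := by
  dsimp only [mapKStar]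
  infer_instance

instance [I.Full] [I.Faithful] (s : Bound) : (mapKStar I s).Faithful := by
  dsimp only [mapKStar]
  infer_instance

variable [I.Full] [I.Faithful]

lemma ShortResolution.isEquivalence_mapDStar (R : ShortResolution I)
    (hI : DetectsStrictExactness I) (hI' : IsStrictlyExactFunctor I) (s : Bound) :
    (hI'.mapDStar s).IsEquivalence := by
  let Φ := hI'.localizerMorphism s
  have : Φ.functor.Full := inferInstanceAs (mapKStar I s).Full
  have : Φ.functor.Faithful := inferInstanceAs (mapKStar I s).Faithful
  have := isLocalizedEquivalence_of_functorial_leftResolutions Φ (R.coneStarP s)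
    (R.qis_coneStarP_app s) (hI.qis_eq s)
  exact Φ.localizedFunctor_isEquivalence (QStar F s) (QStar A s)

variable {κ : A ⥤ F} [κ.Additive] (adj : κ ⊣ I)

/-- For a reflection `κ` onto a full subcategory, the restriction of `κ` to the subcategory is the
identity, on homotopy categories. -/
def mapKStarCompIso (s : Bound) : mapKStar I s ⋙ mapKStar κ s ≅ 𝟭 (KStar F s) :=
  let e : I.mapHomotopyCategory (ComplexShape.up ℤ) ⋙ κ.mapHomotopyCategory _ ≅ 𝟭 _ :=
    Functor.mapHomotopyCategoryCompIso (H := 𝟭 F) (asIso adj.counit) (ComplexShape.up ℤ) ≪≫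
      Quotient.natIsoLift _ (Iso.refl _)
  NatIso.ofComponents (fun X => (bounded F s).isoMk (e.app X.obj))
    (fun f => ObjectProperty.hom_ext _ (e.hom.naturality f.hom))

include adj

/-- Although `κ` need not preserve quasi-isomorphisms, `κ I` is isomorphic to the identity, so it
does on complexes coming from `F`; these serve as the adapted objects. -/
lemma ShortResolution.exists_leftDerived (R : ShortResolution I)
    (hI : DetectsStrictExactness I) (s : Bound) :
    ∃ (Lκ : DStar A s ⥤ DStar F s) (α : QStar A s ⋙ Lκ ⟶ mapKStar κ s ⋙ QStar F s),
      Lκ.IsLeftDerivedFunctor α (qis A s) ∧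
        ∀ X : KStar F s, IsIso (α.app ((mapKStar I s).obj X)) := by
  let Φ := hI.isStrictlyExactFunctor.localizerMorphism s
  have : Φ.functor.Full := inferInstanceAs (mapKStar I s).Full
  have : Φ.functor.Faithful := inferInstanceAs (mapKStar I s).Faithful
  refine exists_isLeftDerivedFunctor Φ (R.coneStarP s) (R.qis_coneStarP_app s) (hI.qis_eq s)
    (QStar A s) (mapKStar κ s ⋙ QStar F s) ?_
  let e : QStar F s ≅ Φ.functor ⋙ mapKStar κ s ⋙ QStar F s :=
    (Functor.leftUnitor _).symm ≪≫ Functor.isoWhiskerRight (mapKStarCompIso adj s).symm _ ≪≫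
      Functor.associator _ _ _
  exact (MorphismProperty.IsInvertedBy.iff_of_iso (qis F s) e).1
    (Localization.inverts (QStar F s) (qis F s))

lemma ShortResolution.hasLeftDerivedFunctor (R : ShortResolution I)
    (hI : DetectsStrictExactness I) (s : Bound) :
    (mapKStar κ s ⋙ QStar F s).HasLeftDerivedFunctor (qis A s) := by
  obtain ⟨Lκ, α, h, -⟩ := R.exists_leftDerived adj hI s
  exact Functor.HasLeftDerivedFunctor.mk' Lκ α

/-- The functor induced by `I` on derived categories is an equivalence whose quasi-inverse is the
left derived functor of the left adjoint of `I`. -/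
lemma ShortResolution.exists_equivalence (R : ShortResolution I)
    (hI : DetectsStrictExactness I) (hI' : IsStrictlyExactFunctor I) (s : Bound)
    (Lκ : DStar A s ⥤ DStar F s) (α : QStar A s ⋙ Lκ ⟶ mapKStar κ s ⋙ QStar F s)
    [Lκ.IsLeftDerivedFunctor α (qis A s)] :
    ∃ e : DStar F s ≌ DStar A s, e.functor = hI'.mapDStar s ∧ e.inverse = Lκ := by
  obtain ⟨L', α', h, hα'⟩ := R.exists_leftDerived adj hI s
  let u : Lκ ≅ L' := Functor.leftDerivedUnique L' Lκ α α' (qis A s)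
  have := R.isEquivalence_mapDStar hI hI' s
  let E := (hI'.mapDStar s).asEquivalence
  let c : mapKStar I s ⋙ QStar A s ≅ QStar F s ⋙ hI'.mapDStar s :=
    ((hI'.localizerMorphism s).catCommSq (QStar F s) (QStar A s)).iso
  let β : mapKStar I s ⋙ QStar A s ⋙ L' ≅ mapKStar I s ⋙ mapKStar κ s ⋙ QStar F s :=
    have : ∀ X, IsIso ((Functor.whiskerLeft (mapKStar I s) α').app X) := hα'
    have := NatIso.isIso_of_isIso_app (Functor.whiskerLeft (mapKStar I s) α')
    asIso (Functor.whiskerLeft (mapKStar I s) α')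
  let γ : QStar F s ⋙ hI'.mapDStar s ⋙ L' ≅ QStar F s ⋙ 𝟭 _ :=
    (Functor.associator _ _ _).symm ≪≫ Functor.isoWhiskerRight c.symm L' ≪≫
      Functor.associator _ _ _ ≪≫ β ≪≫ (Functor.associator _ _ _).symm ≪≫
      Functor.isoWhiskerRight (mapKStarCompIso adj s) _ ≪≫ Functor.leftUnitor _ ≪≫
      (Functor.rightUnitor _).symm
  -- A one-sided inverse suffices, because the functor induced by `I` is already known to be an
  -- equivalence. Uniqueness of derived functors then passes from `L'` to the given `Lκ`.
  let δ : hI'.mapDStar s ⋙ L' ≅ 𝟭 _ :=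
    Localization.liftNatIso (QStar F s) (qis F s) _ _ _ _ γ
  let ε : E.inverse ≅ Lκ :=
    (Functor.rightUnitor _).symm ≪≫ Functor.isoWhiskerLeft E.inverse δ.symm ≪≫
      (Functor.associator _ _ _).symm ≪≫ Functor.isoWhiskerRight E.counitIso L' ≪≫
      Functor.leftUnitor _ ≪≫ u.symm
  exact ⟨E.changeInverse ε, rfl, rfl⟩

end StrictExact

/-! ### Resolution of a functor by coproducts over initial segments -/

namespace FilteredObj

open StrictExact

variable (Λ : Type w) [Preorder Λ] (C : Type u) [Category.{v} C] [Abelian C]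
  [HasColimitsOfSize.{w, w} C]

section

variable {Λ C}

/-- The functor which sends `i` to the coproduct of the `M(j)` for `j ≤ i`. -/
def sumObj (M : Λ ⥤ C) : Λ ⥤ C where
  obj i := ∐ fun j : Set.Iic i => M.obj j
  map s := Sigma.map' (fun j => ⟨j.1, j.2.trans (leOfHom s)⟩) fun _ => 𝟙 _

/-- The transition maps are inclusions of subcoproducts, along `Set.Iic i ⊆ Set.Iic k`. -/
lemma sumObj_mem (M : Λ ⥤ C) : filteredObjects Λ C (sumObj M) := fun i k s =>
  MonoCoprod.mono_map'_of_injective (fun j : Set.Iic k => M.obj j)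
    (fun j : Set.Iic i => (⟨j.1, j.2.trans (leOfHom s)⟩ : Set.Iic k))
    (fun _ _ h => Subtype.ext (congr_arg (fun j : Set.Iic k => j.1) h))

variable {M N : Λ ⥤ C} {i j k : Λ}

variable (M) in
/-- The inclusion of a summand. -/
def sumι (h : j ≤ i) : M.obj j ⟶ (sumObj M).obj i :=
  Sigma.ι (fun j : Set.Iic i => M.obj j) ⟨j, h⟩

omit [Abelian C] in
@[simp]
lemma sumι_map (h : j ≤ i) (s : i ⟶ k) :
    sumι M h ≫ (sumObj M).map s = sumι M (h.trans (leOfHom s)) :=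
  (Sigma.ι_comp_map' (f := fun j : Set.Iic i => M.obj j) (g := fun j : Set.Iic k => M.obj j)
    (fun j => ⟨j.1, j.2.trans (leOfHom s)⟩) (fun _ => 𝟙 _) ⟨j, h⟩).trans (Category.id_comp _)

/-- The morphism from a sum given by morphisms from the summands. -/
def sumDesc {X : C} (f : ∀ j : Λ, j ≤ i → (M.obj j ⟶ X)) : (sumObj M).obj i ⟶ X :=
  Limits.Sigma.desc fun j => f j.1 j.2

omit [Abelian C] in
@[simp]
lemma sumι_sumDesc {X : C} (f : ∀ j : Λ, j ≤ i → (M.obj j ⟶ X)) (h : j ≤ i) :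
    sumι M h ≫ sumDesc f = f j h :=
  Limits.Sigma.ι_desc _ _

omit [Abelian C] in
lemma sum_hom_ext {X : C} {f g : (sumObj M).obj i ⟶ X}
    (h : ∀ (j : Λ) (hj : j ≤ i), sumι M hj ≫ f = sumι M hj ≫ g) : f = g :=
  Limits.Sigma.hom_ext _ _ fun j => h j.1 j.2

omit [Abelian C] in
@[simp]
lemma sumι_map_assoc (h : j ≤ i) (s : i ⟶ k) {X : C} (f : (sumObj M).obj k ⟶ X) :
    sumι M h ≫ (sumObj M).map s ≫ f = sumι M (h.trans (leOfHom s)) ≫ f := by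
  rw [← Category.assoc, sumι_map]

omit [Abelian C] in
@[simp]
lemma sumι_sumDesc_assoc {X Y : C} (f : ∀ j : Λ, j ≤ i → (M.obj j ⟶ X)) (h : j ≤ i)
    (g : X ⟶ Y) : sumι M h ≫ sumDesc f ≫ g = f j h ≫ g := by
  rw [← Category.assoc, sumι_sumDesc]

/-- The morphism of sums induced by a morphism of functors. -/
def sumMap (f : M ⟶ N) : sumObj M ⟶ sumObj N where
  app i := sumDesc fun _ h => f.app _ ≫ sumι N h
  naturality i k s := sum_hom_ext fun j h => by simp

omit [Abelian C] in
@[simp]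
lemma sumι_sumMap_app (f : M ⟶ N) (h : j ≤ i) :
    sumι M h ≫ (sumMap f).app i = f.app j ≫ sumι N h :=
  sumι_sumDesc (fun _ h => f.app _ ≫ sumι N h) h

omit [Abelian C] in
@[simp]
lemma sumι_sumMap_app_assoc (f : M ⟶ N) (h : j ≤ i) {X : C} (g : (sumObj N).obj i ⟶ X) :
    sumι M h ≫ (sumMap f).app i ≫ g = f.app j ≫ sumι N h ≫ g := by
  rw [← Category.assoc, sumι_sumMap_app, Category.assoc]

/-- The morphism onto `M` from the sum of the `M(j)`. -/
def sumProj (M : Λ ⥤ C) : sumObj M ⟶ M where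
  app i := sumDesc fun _ h => M.map (homOfLE h)
  naturality i k s := sum_hom_ext fun j h => by
    simp [← Functor.map_comp, Subsingleton.elim (homOfLE h ≫ s) (homOfLE (h.trans (leOfHom s)))]

omit [Abelian C] in
@[simp]
lemma sumι_sumProj_app (h : j ≤ i) :
    sumι M h ≫ (sumProj M).app i = M.map (homOfLE h) :=
  sumι_sumDesc (fun _ h => M.map (homOfLE h)) h

omit [Abelian C] in
@[simp]
lemma sumι_sumProj_app_assoc (h : j ≤ i) {X : C} (g : M.obj i ⟶ X) :
    sumι M h ≫ (sumProj M).app i ≫ g = M.map (homOfLE h) ≫ g := by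
  rw [← Category.assoc, sumι_sumProj_app]

omit [Abelian C] in
lemma sum_natTrans_ext {f g : sumObj M ⟶ N}
    (h : ∀ (i j : Λ) (hj : j ≤ i), sumι M hj ≫ f.app i = sumι M hj ≫ g.app i) : f = g := by
  ext i
  exact sum_hom_ext (h i)

end

/-- The functor which sends `M` to the functor of the coproducts of the `M(j)` for `j ≤ i`. -/
def sumFunctor : (Λ ⥤ C) ⥤ (Λ ⥤ C) where
  obj := sumObj
  map f := sumMap f
  map_id M := sum_natTrans_ext fun i j h => by simp
  map_comp f g := sum_natTrans_ext fun i j h => by simp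

instance : (sumFunctor Λ C).Additive where
  map_add {M N f g} := by
    change sumMap (f + g) = sumMap f + sumMap g
    exact sum_natTrans_ext fun i j h => by simp

/-- The epimorphism onto `M` from the functor of coproducts of the `M(j)`. -/
def sumπ : sumFunctor Λ C ⟶ 𝟭 (Λ ⥤ C) where
  app M := sumProj M
  naturality M N f := by
    change sumMap f ≫ sumProj N = sumProj M ≫ f
    exact sum_natTrans_ext fun i j h => by simp

instance (M : Λ ⥤ C) : Epi ((sumπ Λ C).app M) := by
  have : ∀ i, Epi (((sumπ Λ C).app M).app i) := fun i => by
    -- The summand of index `j = i` splits the projection at `i`.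
    have h : sumι M le_rfl ≫ ((sumπ Λ C).app M).app i = 𝟙 (M.obj i) :=
      (sumι_sumProj_app le_rfl).trans (M.map_id _)
    exact epi_of_epi_fac h
  exact NatTrans.epi_of_epi_app _

/-- The functor which sends `M` to the filtered object of the coproducts of the `M(j)` for
`j ≤ i`. -/
def sumFilt : (Λ ⥤ C) ⥤ Filt Λ C :=
  (filteredObjects Λ C).lift (sumFunctor Λ C) sumObj_mem

instance : (sumFilt Λ C).Additive where
  map_add := ObjectProperty.hom_ext _ (sumFunctor Λ C).map_add

/-- The kernel of the epimorphism from the filtered object of coproducts. -/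
def sumKernel : (Λ ⥤ C) ⥤ Filt Λ C :=
  -- The kernel is taken among endofunctors of `Λ ⥤ C`, which makes it functorial in `M`. Its values
  -- are filtered as subobjects of filtered objects, so the resolution has length one.
  (filteredObjects Λ C).lift (kernel (sumπ Λ C)) fun M =>
    filteredObjects_of_mono ((kernel.ι (sumπ Λ C)).app M) (sumObj_mem M)

/-- The inclusion of the kernel. -/
def sumKernelι : sumKernel Λ C ⟶ sumFilt Λ C where
  app M := ObjectProperty.homMk ((kernel.ι (sumπ Λ C)).app M)
  naturality _ _ f := ObjectProperty.hom_ext _ ((kernel.ι (sumπ Λ C)).naturality f)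

instance : (sumKernel Λ C).Additive where
  map_add {M N f g} := by
    refine ObjectProperty.hom_ext _ ((cancel_mono ((kernel.ι (sumπ Λ C)).app N)).1 ?_)
    have h (f : M ⟶ N) : (kernel (sumπ Λ C)).map f ≫ (kernel.ι (sumπ Λ C)).app N =
      (kernel.ι (sumπ Λ C)).app M ≫ (sumFunctor Λ C).map f := (kernel.ι (sumπ Λ C)).naturality f
    change (kernel (sumπ Λ C)).map (f + g) ≫ _ =
      ((kernel (sumπ Λ C)).map f + (kernel (sumπ Λ C)).map g) ≫ _
    rw [Preadditive.add_comp, h, h, h, Functor.map_add, ← Preadditive.comp_add]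

/-- The resolutions of functors by filtered objects. -/
def shortResolution : ShortResolution (incl Λ C) where
  P := sumFilt Λ C
  N := sumKernel Λ C
  p := sumπ Λ C
  j := sumKernelι Λ C
  zero M := NatTrans.congr_app (kernel.condition (sumπ Λ C)) M
  shortExact M := by
    have h : (ShortComplex.mk _ _ (kernel.condition (sumπ Λ C))).Exact :=
      ShortComplex.exact_kernel (sumπ Λ C)
    exact
      { exact := h.map ((evaluation (Λ ⥤ C) (Λ ⥤ C)).obj M)
        mono_f := inferInstanceAs (Mono ((kernel.ι (sumπ Λ C)).app M))
        epi_g := inferInstanceAs (Epi ((sumπ Λ C).app M)) }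

end FilteredObj

/-! ### The left heart of an abelian category -/

namespace StrictExact

section Abelian

variable {A : Type u} [Category.{v} A] [Abelian A]

lemma isIso_toD_map {K L : CochainComplex A ℤ} (f : K ⟶ L) [QuasiIso f] :
    IsIso ((toD A).map f) := by
  refine Localization.inverts (QStar A Bound.ub) (qis A Bound.ub) _ ?_
  rw [qis_eq_inverseImage_quasiIso]
  exact (HomotopyCategory.quotient_map_mem_quasiIso_iff f).2 (inferInstanceAs (QuasiIso f))

instance : ((bounded A Bound.ub).ι).EssSurj where
  mem_essImage X := ⟨⟨X, trivial⟩, ⟨Iso.refl _⟩⟩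

instance : ((bounded A Bound.ub).ι).IsEquivalence where

variable [HasDerivedCategory.{w} A]

/-- With no boundedness condition `K*` is equivalent to the whole homotopy category, and its
quasi-isomorphisms are the induced ones. -/
instance isLocalization_ι_comp_Qh :
    ((bounded A Bound.ub).ι ⋙ DerivedCategory.Qh).IsLocalization (qis A Bound.ub) := by
  let Φ : LocalizerMorphism (qis A Bound.ub) (HomotopyCategory.quasiIso A (ComplexShape.up ℤ)) :=
    { functor := (bounded A Bound.ub).ι
      map := (qis_eq_inverseImage_quasiIso (A := A) Bound.ub).le }
  have : Φ.functor.IsEquivalence := inferInstanceAs ((bounded A Bound.ub).ι).IsEquivalence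
  have : Φ.IsInduced := ⟨(qis_eq_inverseImage_quasiIso (A := A) Bound.ub).symm⟩
  have : Φ.IsLocalizedEquivalence := Φ.isLocalizedEquivalence_of_isInduced
  exact LocalizerMorphism.IsLocalizedEquivalence.isLocalization Φ DerivedCategory.Qh

variable (A) in
/-- The comparison with the derived category of an abelian category. -/
def equivalenceDerivedCategory : DStar A Bound.ub ≌ DerivedCategory A :=
  Localization.uniq (QStar A Bound.ub) ((bounded A Bound.ub).ι ⋙ DerivedCategory.Qh)
    (qis A Bound.ub)

variable (A) in
/-- The comparison of the functors from complexes to derived categories. -/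
def toDCompEquivalence : toD A ⋙ (equivalenceDerivedCategory A).functor ≅ DerivedCategory.Q :=
  Functor.isoWhiskerLeft
    ((bounded A Bound.ub).lift (HomotopyCategory.quotient A (ComplexShape.up ℤ)) (fun _ => trivial))
    (Localization.compUniqFunctor (QStar A Bound.ub)
      ((bounded A Bound.ub).ι ⋙ DerivedCategory.Qh) (qis A Bound.ub)) ≪≫
    DerivedCategory.quotientCompQhIso A

variable (A) in
/-- The comparison of the embeddings of `A` in derived categories. -/
def singleDCompEquivalence : singleD A ⋙ (equivalenceDerivedCategory A).functor ≅
    DerivedCategory.singleFunctor A 0 :=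
  Functor.isoWhiskerLeft (HomologicalComplex.single A (ComplexShape.up ℤ) 0)
    (toDCompEquivalence A) ≪≫ (DerivedCategory.singleFunctorIsoCompQ A 0).symm

end Abelian

section Abelian

variable {A : Type u} [Category.{v} A] [Abelian A]

instance : (singleD A).Full :=
  let := HasDerivedCategory.standard A
  have := Functor.Full.of_iso (singleDCompEquivalence A).symm
  Functor.Full.of_comp_faithful (singleD A) (equivalenceDerivedCategory A).functor

instance : (singleD A).Faithful :=
  let := HasDerivedCategory.standard A
  have := Functor.Faithful.of_iso (singleDCompEquivalence A).symm
  Functor.Faithful.of_comp (singleD A) (equivalenceDerivedCategory A).functor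

/-- The left heart of the derived category of an abelian category consists of the complexes
concentrated in degree `0`. -/
lemma leftHeart_eq_essImage_singleD : leftHeart A = (singleD A).essImage := by
  let := HasDerivedCategory.standard A
  ext X
  constructor
  · rintro ⟨⟨K, hK, ⟨e⟩⟩, ⟨L, hL, ⟨e'⟩⟩⟩
    let E := equivalenceDerivedCategory A
    have : K.IsLE 0 := by
      rw [CochainComplex.isLE_iff]
      exact fun i hi => (isStrictlyExactAt_iff_exactAt K i).1 (hK i hi)
    have : L.IsGE 0 := by
      rw [CochainComplex.isGE_iff]
      exact fun i hi => (isStrictlyExactAt_iff_exactAt L i).1 (hL i hi)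
    -- The two bounds come from different complexes `K` and `L`; they meet only as properties of the
    -- object for the canonical t-structure.
    have : (E.functor.obj X).IsLE 0 := DerivedCategory.TStructure.t.isLE_of_iso
      (((toDCompEquivalence A).app K).symm ≪≫ E.functor.mapIso e) 0
    have : (E.functor.obj X).IsGE 0 := DerivedCategory.TStructure.t.isGE_of_iso
      (((toDCompEquivalence A).app L).symm ≪≫ E.functor.mapIso e') 0
    obtain ⟨Y, ⟨i⟩⟩ :=
      DerivedCategory.exists_iso_singleFunctor_obj_of_isGE_of_isLE (E.functor.obj X) 0
    exact ⟨Y, ⟨E.functor.preimageIso ((singleDCompEquivalence A).app Y ≪≫ i.symm)⟩⟩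
  · rintro ⟨Y, ⟨e⟩⟩
    have h (n : ℤ) (hn : n ≠ 0) :
        IsStrictlyExactAt ((HomologicalComplex.single A (ComplexShape.up ℤ) 0).obj Y) n :=
      (isStrictlyExactAt_iff_exactAt _ n).2 (HomologicalComplex.exactAt_single_obj _ _ _ _ hn)
    exact ⟨⟨_, fun k hk => h k hk.ne', ⟨e⟩⟩, ⟨_, fun k hk => h k hk.ne, ⟨e⟩⟩⟩

/-! ### Transport of the left heart along the equivalence -/

variable {F : Type u'} [Category.{v'} F] [Preadditive F] [HasZeroObject F] [HasBinaryBiproducts F]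
  [HasKernels F] [HasCokernels F] {I : F ⥤ A} [I.Additive]

/-- The functor induced on derived categories by a strictly exact functor is given by the
application of the functor to complexes. -/
def toDCompMapDStar (hI : IsStrictlyExactFunctor I) :
    toD F ⋙ hI.mapDStar Bound.ub ≅ I.mapHomologicalComplex (ComplexShape.up ℤ) ⋙ toD A :=
  Functor.isoWhiskerLeft
    ((bounded F Bound.ub).lift (HomotopyCategory.quotient F (ComplexShape.up ℤ)) (fun _ => trivial))
    ((hI.localizerMorphism Bound.ub).catCommSq
      (QStar F Bound.ub) (QStar A Bound.ub)).iso.symm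

variable [I.Full] [I.Faithful]

/-- A representative in `F` is mapped by `I`; a representative in `A` is replaced by its cone
resolution, a quasi-isomorphic complex, hence exact in the same degrees. The predicate `P` covers `k
> 0` and `k < 0` at once. -/
lemma ShortResolution.exists_toD_obj_iso (R : ShortResolution I)
    (hI : DetectsStrictExactness I) (hI' : IsStrictlyExactFunctor I) (X : DStar F Bound.ub)
    (P : ℤ → Prop) : (∃ K : CochainComplex F ℤ,
      (∀ k : ℤ, P k → IsStrictlyExactAt K k) ∧ Nonempty ((toD F).obj K ≅ X)) ↔
    ∃ K : CochainComplex A ℤ, (∀ k : ℤ, P k → IsStrictlyExactAt K k) ∧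
      Nonempty ((toD A).obj K ≅ (hI'.mapDStar Bound.ub).obj X) := by
  constructor
  · rintro ⟨K, hK, ⟨e⟩⟩
    exact ⟨_, fun k hk => (hI.isStrictlyExactAt_iff K k).1 (hK k hk),
      ⟨((toDCompMapDStar hI').app K).symm ≪≫ (hI'.mapDStar Bound.ub).mapIso e⟩⟩
  · rintro ⟨K, hK, ⟨e⟩⟩
    have := R.isEquivalence_mapDStar hI hI' Bound.ub
    have := isIso_toD_map (R.conePApp K)
    refine ⟨R.cone.obj K, fun k hk => (hI.isStrictlyExactAt_iff _ k).2 ?_,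
      ⟨(hI'.mapDStar Bound.ub).preimageIso ((toDCompMapDStar hI').app _ ≪≫
        asIso ((toD A).map (R.conePApp K)) ≪≫ e)⟩⟩
    rw [isStrictlyExactAt_iff_exactAt, exactAt_iff_of_quasiIsoAt (R.conePApp K),
      ← isStrictlyExactAt_iff_exactAt]
    exact hK k hk

lemma ShortResolution.leftHeart_eq_inverseImage (R : ShortResolution I)
    (hI : DetectsStrictExactness I) (hI' : IsStrictlyExactFunctor I) :
    leftHeart F = (leftHeart A).inverseImage (hI'.mapDStar Bound.ub) := by
  ext X
  exact and_congr (R.exists_toD_obj_iso hI hI' X _) (R.exists_toD_obj_iso hI hI' X _)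

end Abelian

section

/-- Fully faithful functors with the same essential image have equivalent sources. -/
lemma exists_equivalence_of_essImage_eq {X Y D : Type*} [Category* X] [Category* Y] [Category* D]
    (F : X ⥤ D) (G : Y ⥤ D) [F.Full] [F.Faithful] [G.Full] [G.Faithful]
    (h : F.essImage = G.essImage) : ∃ e : X ≌ Y, Nonempty (e.functor ⋙ G ≅ F) := by
  let F' : X ⥤ G.EssImageSubcategory := G.essImage.lift F fun Z => by
    rw [← h]
    exact F.obj_mem_essImage Z
  have : F'.Full := inferInstanceAs (G.essImage.lift F _).Full
  have : F'.Faithful := inferInstanceAs (G.essImage.lift F _).Faithful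
  have : F'.EssSurj := ⟨fun Z => by
    obtain ⟨W, ⟨i⟩⟩ := h.ge _ Z.property
    exact ⟨W, ⟨G.essImage.isoMk i⟩⟩⟩
  have : F'.IsEquivalence := { }
  let e := F'.asEquivalence.trans G.toEssImage.asEquivalence.symm
  exact ⟨e, ⟨Functor.associator _ _ _ ≪≫ Functor.isoWhiskerLeft F'
    (Functor.isoWhiskerLeft _ G.toEssImageCompι.symm ≪≫ (Functor.associator _ _ _).symm ≪≫
      Functor.isoWhiskerRight G.toEssImage.asEquivalence.counitIso _ ≪≫ Functor.leftUnitor _)⟩⟩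

variable {A : Type u} [Category.{v} A] [Abelian A]
variable {F : Type u'} [Category.{v'} F] [Preadditive F] [HasZeroObject F] [HasBinaryBiproducts F]
  [HasKernels F] [HasCokernels F] {I : F ⥤ A} [I.Additive] [I.Full] [I.Faithful]

/-- Both categories embed fully faithfully in the derived category of `A`, with the same essential
image, the left heart of `A`. -/
lemma ShortResolution.exists_equivalence_leftHeart (R : ShortResolution I)
    (hI : DetectsStrictExactness I) (hI' : IsStrictlyExactFunctor I) :
    ∃ e : LH F ≌ A, Nonempty (e.functor ⋙ singleD A ≅
      (leftHeart F).ι ⋙ hI'.mapDStar Bound.ub) := by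
  have := R.isEquivalence_mapDStar hI hI' Bound.ub
  refine exists_equivalence_of_essImage_eq _ _ ?_
  rw [← leftHeart_eq_essImage_singleD]
  ext X
  constructor
  · rintro ⟨Y, ⟨i⟩⟩
    have h : leftHeart A ((hI'.mapDStar Bound.ub).obj Y.obj) :=
      (R.leftHeart_eq_inverseImage hI hI').le _ Y.property
    rw [leftHeart_eq_essImage_singleD] at h ⊢
    exact Functor.essImage.ofIso i h
  · intro h
    let Y := (hI'.mapDStar Bound.ub).objPreimage X
    let i : (hI'.mapDStar Bound.ub).obj Y ≅ X := (hI'.mapDStar Bound.ub).objObjPreimageIso X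
    refine ⟨⟨Y, (R.leftHeart_eq_inverseImage hI hI').ge _ ?_⟩, ⟨i⟩⟩
    change leftHeart A ((hI'.mapDStar Bound.ub).obj Y)
    rw [leftHeart_eq_essImage_singleD] at h ⊢
    exact Functor.essImage.ofIso i.symm h

/-- A category that is equivalent to an abelian category is abelian. -/
lemma exists_abelian_of_equivalence {X : Type*} [Category* X] (e : X ≌ A) :
    ∃ _ : Abelian X, e.functor.Additive := by
  -- The additive structure is transported along `e`, so `e` is additive by construction.
  let : Preadditive X := .ofFullyFaithful e.fullyFaithfulFunctor
  have h : e.functor.Additive := e.fullyFaithfulFunctor.additive_ofFullyFaithful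
  have : HasFiniteProducts X := ⟨fun n => Adjunction.hasLimitsOfShape_of_equivalence e.functor⟩
  exact ⟨abelianOfEquivalence e.functor, h⟩

end

end StrictExact

end

theorem mainTheorem1 {C : Type u} [Category.{v} C] [Abelian C]
    [HasColimitsOfSize.{w, w} C] [AB5OfSize.{w, w} C]
    (Λ : Type w) [Preorder Λ] [IsDirectedOrder Λ] [Nonempty Λ] :
    ∃ hι : StrictExact.IsStrictlyExactFunctor (FilteredObj.incl Λ C),
      (∀ s : StrictExact.Bound,
        (StrictExact.mapKStar (FilteredObj.kappa Λ C) s ⋙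
            StrictExact.QStar (FilteredObj.Filt Λ C) s).HasLeftDerivedFunctor
          (StrictExact.qis (Λ ⥤ C) s) ∧
        ∀ (Lκ : StrictExact.DStar (Λ ⥤ C) s ⥤ StrictExact.DStar (FilteredObj.Filt Λ C) s)
          (α : StrictExact.QStar (Λ ⥤ C) s ⋙ Lκ ⟶
            StrictExact.mapKStar (FilteredObj.kappa Λ C) s ⋙
              StrictExact.QStar (FilteredObj.Filt Λ C) s),
          Lκ.IsLeftDerivedFunctor α (StrictExact.qis (Λ ⥤ C) s) →
          ∃ e : StrictExact.DStar (FilteredObj.Filt Λ C) s ≌ StrictExact.DStar (Λ ⥤ C) s,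
            e.functor = hι.mapDStar s ∧ e.inverse = Lκ) ∧
      ∃ (_ : Abelian (StrictExact.LH (FilteredObj.Filt Λ C)))
        (e : StrictExact.LH (FilteredObj.Filt Λ C) ≌ (Λ ⥤ C)),
        e.functor.Additive ∧
        Nonempty (e.functor ⋙ StrictExact.singleD (Λ ⥤ C) ≅
          (StrictExact.leftHeart (FilteredObj.Filt Λ C)).ι ⋙
            hι.mapDStar StrictExact.Bound.ub) := by
  let R := FilteredObj.shortResolution Λ C
  have hI : StrictExact.DetectsStrictExactness (FilteredObj.incl Λ C) :=
    FilteredObj.isStrictlyExact_iff_exact_incl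
  have hι := hI.isStrictlyExactFunctor
  refine ⟨hι, fun s => ⟨R.hasLeftDerivedFunctor (FilteredObj.kappaAdj Λ C) hI s,
    fun Lκ α _ => R.exists_equivalence (FilteredObj.kappaAdj Λ C) hI hι s Lκ α⟩, ?_⟩
  obtain ⟨e, he⟩ := R.exists_equivalence_leftHeart hI hι
  obtain ⟨h, hadd⟩ := StrictExact.exists_abelian_of_equivalence e
  exact ⟨h, e, hadd, he⟩
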